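/- Let $d\in\mathbb N$, let $A$ be a complex $d\times d$ Hurwitz matrix (all eigenvalues of $A$ have negative real part), and let $D\subset\mathbb C^d$ be a domain (non-empty connected open set) containing the origin. Assume that $e^{tA}z\in D$ and $e^{isA}z\in D$ for all $z\in D$, all real $t\ge 0$ and all $s\in(-\frac{\pi}{2},\frac{\pi}{2})$. Then the following are equivalent: 1. $D$ is bounded. 2. $D$ is biholomorphic to a bounded domain in $\mathbb C^d$. 3. $D$ is Kobayashi hyperbolic, that is, its Kobayashi pseudo-distance $K_D$ is a distance ($K_D(z,w)=0$ implies $z=w$). 4. The core of $D$, that is, the set of all $\zeta\in D$ such that every (real-valued) continuous plurisubharmonic function on $D$ that is bounded from above fails to be strictly plurisubharmonic at $\zeta$, is empty. Here $\varphi$ is strictly plurisubharmonic at $\zeta$ if for some $\varepsilon>0$ the function $z\mapsto\varphi(z)-\varepsilon\|z\|^2$ is plurisubharmonic in a neighbourhood of $\zeta$. 5. $D$ is Carathéodory hyperbolic, that is, its Carathéodory pseudo-distance $C_D$ is a distance ($C_D(z,w)=0$ implies $z=w$). -/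

import Mathlib

open scoped ENNReal

noncomputable section

/-- A domain in `ℂ^d`: a non-empty connected open set. -/
def IsDomainIn {d : ℕ} (D : Set (EuclideanSpace ℂ (Fin d))) : Prop :=
  IsOpen D ∧ IsConnected D

/-- A (complex) matrix is Hurwitz if all its eigenvalues have negative real part. -/
def IsHurwitz {d : ℕ} (A : Matrix (Fin d) (Fin d) ℂ) : Prop :=
  ∀ μ ∈ spectrum ℂ A, μ.re < 0

/-- The flow `z ↦ e^{lam A} z` of the linear vector field `A`, at complex time `lam`. -/
def linearFlow {d : ℕ} (A : Matrix (Fin d) (Fin d) ℂ) (lam : ℂ)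
    (z : EuclideanSpace ℂ (Fin d)) : EuclideanSpace ℂ (Fin d) :=
  Matrix.toEuclideanLin (NormedSpace.exp (lam • A)) z

/-- `D` is spirallike with respect to the linear vector field `A`. -/
def IsSpirallike {d : ℕ} (A : Matrix (Fin d) (Fin d) ℂ)
    (D : Set (EuclideanSpace ℂ (Fin d))) : Prop :=
  ∀ t : ℝ, 0 ≤ t → ∀ z ∈ D, linearFlow A (t : ℂ) z ∈ D

/-- `D` is circularlike with respect to the linear vector field `A`. -/
def IsCircularlike {d : ℕ} (A : Matrix (Fin d) (Fin d) ℂ)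
    (D : Set (EuclideanSpace ℂ (Fin d))) : Prop :=
  ∀ s ∈ Set.Ioo (-(Real.pi / 2)) (Real.pi / 2), ∀ z ∈ D,
    linearFlow A (Complex.I * (s : ℂ)) z ∈ D

/-- `D` and `G` are biholomorphic: there are mutually inverse holomorphic maps between them. -/
def AreBiholomorphic {d : ℕ} (D G : Set (EuclideanSpace ℂ (Fin d))) : Prop :=
  ∃ f g : EuclideanSpace ℂ (Fin d) → EuclideanSpace ℂ (Fin d),
    DifferentiableOn ℂ f D ∧ DifferentiableOn ℂ g G ∧
      Set.MapsTo f D G ∧ Set.MapsTo g G D ∧ Set.InvOn g f D G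

/-- The Poincaré distance on the open unit disc. -/
def poincareDist (a b : ℂ) : ℝ :=
  Real.artanh (‖a - b‖ / ‖1 - (starRingEnd ℂ) b * a‖)

/-- The Carathéodory pseudo-distance of `D`: the supremum of the Poincaré distances of
`f z` and `f w`, over all holomorphic `f` from `D` to the unit disc. -/
def caratheodoryDist {d : ℕ} (D : Set (EuclideanSpace ℂ (Fin d)))
    (z w : EuclideanSpace ℂ (Fin d)) : ℝ≥0∞ :=
  ⨆ (f : EuclideanSpace ℂ (Fin d) → ℂ) (_ : DifferentiableOn ℂ f D)
    (_ : Set.MapsTo f D (Metric.ball (0 : ℂ) 1)), ENNReal.ofReal (poincareDist (f z) (f w))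

/-- The Lempert function of `D`: the infimum of the Poincaré distances of `a` and `b`, over all
holomorphic discs `f` in `D` with `f a = z` and `f b = w` (`∞` if there is no such disc). -/
def lempertFunction {d : ℕ} (D : Set (EuclideanSpace ℂ (Fin d)))
    (z w : EuclideanSpace ℂ (Fin d)) : ℝ≥0∞ :=
  ⨅ (f : ℂ → EuclideanSpace ℂ (Fin d)) (a : ℂ) (b : ℂ)
    (_ : DifferentiableOn ℂ f (Metric.ball (0 : ℂ) 1))
    (_ : Set.MapsTo f (Metric.ball (0 : ℂ) 1) D)
    (_ : a ∈ Metric.ball (0 : ℂ) 1) (_ : b ∈ Metric.ball (0 : ℂ) 1)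
    (_ : f a = z) (_ : f b = w), ENNReal.ofReal (poincareDist a b)

/-- The Kobayashi pseudo-distance of `D`: the infimum of the sums of the Lempert function
along finite chains `z = p 0, p 1, …, p n = w` of points of `D`. -/
def kobayashiDist {d : ℕ} (D : Set (EuclideanSpace ℂ (Fin d)))
    (z w : EuclideanSpace ℂ (Fin d)) : ℝ≥0∞ :=
  ⨅ (n : ℕ) (p : ℕ → EuclideanSpace ℂ (Fin d)) (_ : p 0 = z) (_ : p n = w)
    (_ : ∀ i ≤ n, p i ∈ D), ∑ i ∈ Finset.range n, lempertFunction D (p i) (p (i + 1))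

/-- `D` is Carathéodory hyperbolic: the pseudo-distance separates the points of `D`. -/
def IsCaratheodoryHyperbolic {d : ℕ} (D : Set (EuclideanSpace ℂ (Fin d))) : Prop :=
  ∀ z ∈ D, ∀ w ∈ D, caratheodoryDist D z w = 0 → z = w

/-- `D` is Kobayashi hyperbolic: the pseudo-distance separates the points of `D`. -/
def IsKobayashiHyperbolic {d : ℕ} (D : Set (EuclideanSpace ℂ (Fin d))) : Prop :=
  ∀ z ∈ D, ∀ w ∈ D, kobayashiDist D z w = 0 → z = w

/-- A continuous plurisubharmonic function on an open set `U`: a (finite) continuous function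
with the sub-mean value property on every closed affine disc `{a + lam b : |lam| ≤ 1}` in `U`. -/
def IsContinuousPSHOn {d : ℕ} (φ : EuclideanSpace ℂ (Fin d) → ℝ)
    (U : Set (EuclideanSpace ℂ (Fin d))) : Prop :=
  ContinuousOn φ U ∧
    ∀ a b : EuclideanSpace ℂ (Fin d), (∀ lam : ℂ, ‖lam‖ ≤ 1 → a + lam • b ∈ U) →
      φ a ≤ Real.circleAverage (fun lam : ℂ => φ (a + lam • b)) 0 1

/-- `φ` is strictly plurisubharmonic at `ζ`: for some `ε > 0` the function `φ - ε ‖z‖²` is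
(continuous) plurisubharmonic in a neighbourhood of `ζ`. -/
def IsStrictlyPSHAt {d : ℕ} (φ : EuclideanSpace ℂ (Fin d) → ℝ)
    (ζ : EuclideanSpace ℂ (Fin d)) : Prop :=
  ∃ ε > 0, ∃ r > 0, IsContinuousPSHOn (fun z => φ z - ε * ‖z‖ ^ 2) (Metric.ball ζ r)

/-- The core of `D`: the points of `D` at which every continuous plurisubharmonic function on
`D` that is bounded from above fails to be strictly plurisubharmonic. -/
def domainCore {d : ℕ} (D : Set (EuclideanSpace ℂ (Fin d))) :
    Set (EuclideanSpace ℂ (Fin d)) :=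
  {ζ | ζ ∈ D ∧ ∀ φ : EuclideanSpace ℂ (Fin d) → ℝ, IsContinuousPSHOn φ D →
    BddAbove (φ '' D) → ¬ IsStrictlyPSHAt φ ζ}

end

/-!
If `D` is bounded, the coordinates separate its points by bounded holomorphic functions and `‖·‖²`
is a bounded strictly plurisubharmonic function. This gives (1) ⇒ (2) ⇒ (5) and (1) ⇒ (4), and
(5) ⇒ (3) is the Schwarz–Pick lemma. Only (3) ⇒ (1) and (4) ⇒ (1) use the symmetries of `D`.

Together, the two invariance hypotheses say that `e^{lam A}` maps `D` into itself whenever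
`0 ≤ re lam`. If `D` is unbounded, take points `z n` of `D` tending to infinity and flow each of
them, for a time `t n`, to a fixed small sphere around `0`. The points `w n = e^{t n A} z n` satisfy
`e^{lam A} (w n) ∈ D` for `|lam| ≤ t n`, the times `t n` tend to infinity, and along a subsequence
`w n` converges to a point `w ≠ 0` of `D` (`exists_isLimitOfFlowDiscs`). So near `w` there are
holomorphic discs of arbitrarily large radius along the flow, although the entire curve through `w`
itself need not stay in `D`.

* The Lempert function of `w n` and `e^A (w n)` tends to `0`, so the Kobayashi pseudo-distance of
  `w` and `e^A w ≠ w` vanishes (`IsLimitOfFlowDiscs.kobayashiDist_eq_zero`).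
* Let `φ` be continuous, plurisubharmonic and bounded above on `D`. The three circles theorem on the
  large discs shows that `lam ↦ φ (e^{lam A} w)` has a maximum at `0`
  (`IsLimitOfFlowDiscs.comp_linearFlow_le`). As `‖e^{lam A} w‖²` is strictly subharmonic, `φ` is not
  strictly plurisubharmonic at `w`, and `w` lies in the core (`IsLimitOfFlowDiscs.mem_domainCore`).

The second point needs a maximum principle for `φ ∘ f` with `f` a holomorphic curve, while the
definition of plurisubharmonicity only mentions affine discs. Instead of regularizing `φ`, the proof
doubles the variables: it maximizes `φ z - q l - N ‖z - f l‖²` over `z` near `f l`, for a strictly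
superharmonic comparison function `q`, and at the maximum it moves `l` along a small circle and `z`
along the affine disc tangent to `f` (`IsContinuousPSHOn.comp_le_of_le_frontier`).
-/

section

open Filter Topology

section

/-! ### The complex-time linear flow -/

section ExpFlow

variable {E : Type*} [NormedAddCommGroup E] [NormedSpace ℂ E]

/-- The operator `exp (lam B)`. Stating it over a general complex normed space fixes the module
structure on `E →L[ℂ] E`. -/
noncomputable def expFlow (B : E →L[ℂ] E) (lam : ℂ) : E →L[ℂ] E := NormedSpace.exp (lam • B)

variable (B : E →L[ℂ] E)

lemma expFlow_zero : expFlow B 0 = 1 := by simp [expFlow]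

lemma map_exp_smul_eq_expFlow {R : Type*} [NormedRing R] [NormedAlgebra ℂ R] [CompleteSpace R]
    (Φ : R →ₐ[ℂ] (E →L[ℂ] E)) (hΦ : Continuous Φ) (lam : ℂ) (a : R) :
    Φ (NormedSpace.exp (lam • a)) = expFlow (Φ a) lam := by
  let _ : NormedAlgebra ℚ R := .restrictScalars ℚ ℂ _
  let _ : NormedAlgebra ℚ (E →L[ℂ] E) := .restrictScalars ℚ ℂ _
  rw [expFlow, NormedSpace.map_exp Φ hΦ, map_smul]

variable [CompleteSpace E]

lemma expFlow_add (a b : ℂ) : expFlow B (a + b) = expFlow B a * expFlow B b := by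
  let _ : NormedAlgebra ℚ (E →L[ℂ] E) := .restrictScalars ℚ ℂ _
  rw [expFlow, add_smul,
    NormedSpace.exp_add_of_commute (((Commute.refl B).smul_left a).smul_right b)]
  rfl

lemma hasDerivAt_expFlow (lam : ℂ) : HasDerivAt (expFlow B) (B * expFlow B lam) lam :=
  hasDerivAt_exp_smul_const' B lam

lemma continuous_expFlow_apply : Continuous fun p : ℂ × E => expFlow B p.1 p.2 := by
  have h : Continuous (expFlow B) :=
    continuous_iff_continuousAt.2 fun l => (hasDerivAt_expFlow B l).continuousAt
  exact (h.comp continuous_fst).clm_apply continuous_snd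

/-- On a generalized eigenvector of a bounded operator `B`, the exponential series of `B - μ`
terminates, so that `exp (tB) v` is `exp (tμ)` times a polynomial in `t`. -/
lemma expFlow_apply_of_genEigenvector (μ : ℂ) (v : E) (k : ℕ) (hv : ((B - μ • 1) ^ k) v = 0)
    (t : ℂ) :
    expFlow B t v =
      ∑ n ∈ Finset.range k, (Complex.exp (t * μ) * t ^ n) •
        ((n.factorial : ℂ)⁻¹ • ((B - μ • 1) ^ n) v) := by
  let _ : NormedAlgebra ℚ (E →L[ℂ] E) := .restrictScalars ℚ ℂ _
  set N := B - μ • (1 : E →L[ℂ] E) with hN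
  have hsplit : t • B = (t * μ) • (1 : E →L[ℂ] E) + t • N := by
    rw [hN, smul_sub, smul_smul]; abel
  have hzero : ∀ n, k ≤ n → (N ^ n) v = 0 := by
    intro n hn
    obtain ⟨m, rfl⟩ := Nat.exists_eq_add_of_le hn
    rw [add_comm, pow_add, mul_apply_eq_comp, hv, map_zero]
  have hscal : NormedSpace.exp ((t * μ) • (1 : E →L[ℂ] E)) =
      Complex.exp (t * μ) • (1 : E →L[ℂ] E) := by
    have := (NormedSpace.algebraMap_exp_comm (𝕂 := ℂ) (𝔸 := E →L[ℂ] E) (t * μ)).symm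
    rwa [Algebra.algebraMap_eq_smul_one, Algebra.algebraMap_eq_smul_one,
      ← Complex.exp_eq_exp_ℂ] at this
  have hsum := (NormedSpace.exp_series_hasSum_exp' (𝕂 := ℂ) (t • N)).mapL
    (ContinuousLinearMap.apply ℂ E v)
  have hfin : NormedSpace.exp (t • N) v =
      ∑ n ∈ Finset.range k, ((n.factorial : ℂ)⁻¹ • (t • N) ^ n) v := by
    refine hsum.unique (hasSum_sum_of_ne_finset_zero ?_)
    intro n hn
    have := hzero n (by simpa using hn)
    simp [smul_pow, this]
  rw [expFlow, hsplit, NormedSpace.exp_add_of_commute ((Commute.one_left _).smul_left _), hscal,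
    mul_apply_eq_comp, hfin]
  simp only [smul_apply, one_apply_eq_self, Finset.smul_sum, smul_pow, smul_smul]
  refine Finset.sum_congr rfl fun n _ => ?_
  congr 1; ring

end ExpFlow

variable {d : ℕ} (A : Matrix (Fin d) (Fin d) ℂ)

lemma linearFlow_eq_expFlow (lam : ℂ) (z : EuclideanSpace ℂ (Fin d)) :
    linearFlow A lam z = expFlow (Matrix.toEuclideanCLM (n := Fin d) (𝕜 := ℂ) A) lam z := by
  let _ : NormedRing (Matrix (Fin d) (Fin d) ℂ) := Matrix.linftyOpNormedRing
  let _ : NormedAlgebra ℂ (Matrix (Fin d) (Fin d) ℂ) := Matrix.linftyOpNormedAlgebra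
  have h := map_exp_smul_eq_expFlow
    (Matrix.toEuclideanCLM (n := Fin d) (𝕜 := ℂ)).toAlgEquiv.toAlgHom
    (LinearMap.continuous_of_finiteDimensional
      (Matrix.toEuclideanCLM (n := Fin d) (𝕜 := ℂ)).toAlgEquiv.toLinearMap) lam A
  exact DFunLike.congr_fun h z

lemma linearFlow_zero_left (z : EuclideanSpace ℂ (Fin d)) : linearFlow A 0 z = z := by
  rw [linearFlow_eq_expFlow, expFlow_zero, one_apply_eq_self]

lemma linearFlow_add (a b : ℂ) (z : EuclideanSpace ℂ (Fin d)) :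
    linearFlow A (a + b) z = linearFlow A a (linearFlow A b z) := by
  simp only [linearFlow_eq_expFlow, expFlow_add, mul_apply_eq_comp]

lemma linearFlow_neg_linearFlow (a : ℂ) (z : EuclideanSpace ℂ (Fin d)) :
    linearFlow A (-a) (linearFlow A a z) = z := by
  rw [← linearFlow_add, neg_add_cancel, linearFlow_zero_left]

lemma hasDerivAt_linearFlow (lam : ℂ) (z : EuclideanSpace ℂ (Fin d)) :
    HasDerivAt (fun l => linearFlow A l z)
      (Matrix.toEuclideanCLM (n := Fin d) (𝕜 := ℂ) A (linearFlow A lam z)) lam := by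
  simp only [linearFlow_eq_expFlow]
  exact ((hasDerivAt_expFlow _ lam).clm_apply (hasDerivAt_const lam z)).congr_deriv (by simp)

lemma differentiable_linearFlow (z : EuclideanSpace ℂ (Fin d)) :
    Differentiable ℂ (fun l => linearFlow A l z) :=
  fun lam => (hasDerivAt_linearFlow A lam z).differentiableAt

lemma continuous_linearFlow :
    Continuous (fun p : ℂ × EuclideanSpace ℂ (Fin d) => linearFlow A p.1 p.2) := by
  simp only [linearFlow_eq_expFlow]
  exact continuous_expFlow_apply _

lemma continuous_linearFlow_right (lam : ℂ) : Continuous (linearFlow A lam) :=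
  (Matrix.toEuclideanLin (NormedSpace.exp (lam • A))).continuous_of_finiteDimensional

/-! ### Decay of the flow of a Hurwitz matrix -/

lemma tendsto_cexp_mul_pow_of_re_neg {μ : ℂ} (hμ : μ.re < 0) (n : ℕ) :
    Tendsto (fun t : ℝ => Complex.exp (t * μ) * (t : ℂ) ^ n) atTop (𝓝 0) := by
  rw [tendsto_zero_iff_norm_tendsto_zero]
  have h := (Real.tendsto_pow_mul_exp_neg_atTop_nhds_zero n).comp
    (tendsto_id.const_mul_atTop (show 0 < -μ.re by linarith))
  have h2 := h.const_mul (((-μ.re) ^ n)⁻¹)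
  rw [mul_zero] at h2
  refine h2.congr' ?_
  filter_upwards [eventually_ge_atTop 0] with t ht
  have h3 : (-μ.re) ^ n ≠ 0 := pow_ne_zero _ (by linarith)
  simp only [Function.comp, id, norm_mul, Complex.norm_exp, norm_pow, Complex.norm_real,
    Real.norm_eq_abs, abs_of_nonneg ht, Complex.re_ofReal_mul, mul_pow]
  rw [show -(-μ.re * t) = t * μ.re by ring]
  field_simp

variable {A}

/-- Since the generalized eigenspaces span, it is enough to look at generalized eigenvectors. -/
lemma IsHurwitz.tendsto_linearFlow (hA : IsHurwitz A) (z : EuclideanSpace ℂ (Fin d)) :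
    Tendsto (fun t : ℝ => linearFlow A t z) atTop (𝓝 0) := by
  set B : EuclideanSpace ℂ (Fin d) →L[ℂ] EuclideanSpace ℂ (Fin d) :=
    Matrix.toEuclideanCLM (n := Fin d) (𝕜 := ℂ) A with hB
  set f : Module.End ℂ (EuclideanSpace ℂ (Fin d)) := Matrix.toEuclideanLin A with hf
  let S : Submodule ℂ (EuclideanSpace ℂ (Fin d)) :=
    { carrier := {v | Tendsto (fun t : ℝ => linearFlow A t v) atTop (𝓝 0)}
      add_mem' := fun {a b} ha hb => by
        simpa [linearFlow] using Tendsto.add ha hb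
      zero_mem' := by simp [linearFlow]
      smul_mem' := fun c a ha => by
        simpa [linearFlow] using Tendsto.const_smul ha c }
  suffices h : (⊤ : Submodule ℂ (EuclideanSpace ℂ (Fin d))) ≤ S from h trivial
  rw [← Module.End.iSup_maxGenEigenspace_eq_top f]
  refine iSup_le fun μ v hv => ?_
  obtain ⟨k, hk⟩ := (Module.End.mem_maxGenEigenspace f μ v).1 hv
  by_cases hv0 : v = 0
  · rw [hv0]; exact S.zero_mem
  have hμ : μ.re < 0 := by
    refine hA μ ?_
    have h1 : f.HasGenEigenvalue μ k := by
      rw [Module.End.hasGenEigenvalue_iff, Submodule.ne_bot_iff]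
      exact ⟨v, Module.End.mem_genEigenspace_nat.2 hk, hv0⟩
    have h2 := (Module.End.hasEigenvalue_of_hasGenEigenvalue h1).mem_spectrum
    rwa [hf, Matrix.spectrum_toLpLin] at h2
  have hkB : ((B - μ • 1) ^ k) v = 0 := by
    have : ∀ n, ∀ x : EuclideanSpace ℂ (Fin d),
        ((B - μ • (1 : EuclideanSpace ℂ (Fin d) →L[ℂ] EuclideanSpace ℂ (Fin d))) ^ n) x =
          ((f - μ • (1 : Module.End ℂ (EuclideanSpace ℂ (Fin d)))) ^ n) x := by
      intro n
      induction n with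
      | zero => intro x; rfl
      | succ n ih =>
        intro x
        rw [pow_succ, pow_succ, mul_apply_eq_comp, Module.End.mul_apply, ih]
        rfl
    rw [this, hk]
  change Tendsto (fun t : ℝ => linearFlow A t v) atTop (𝓝 0)
  simp only [linearFlow_eq_expFlow, ← hB, expFlow_apply_of_genEigenvector B μ v k hkB]
  have : ∀ n ∈ Finset.range k, Tendsto (fun t : ℝ => (Complex.exp (t * μ) * (t : ℂ) ^ n) •
      ((n.factorial : ℂ)⁻¹ • ((B - μ • 1) ^ n) v)) atTop (𝓝 0) := fun n _ => by
    simpa using (tendsto_cexp_mul_pow_of_re_neg hμ n).smul_const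
      ((n.factorial : ℂ)⁻¹ • ((B - μ • 1) ^ n) v)
  simpa using tendsto_finsetSum _ this

lemma IsHurwitz.eq_zero_of_linearFlow_one_eq (hA : IsHurwitz A) {w : EuclideanSpace ℂ (Fin d)}
    (hw : linearFlow A 1 w = w) : w = 0 := by
  have h : ∀ n : ℕ, linearFlow A ((n : ℝ) : ℂ) w = w := by
    intro n
    induction n with
    | zero => simpa using linearFlow_zero_left A w
    | succ n ih =>
      push_cast at ih ⊢
      rw [linearFlow_add, hw, ih]
  have h1 := (hA.tendsto_linearFlow w).comp tendsto_natCast_atTop_atTop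
  refine tendsto_nhds_unique (tendsto_const_nhds.congr fun n => ?_) h1
  exact (h n).symm

lemma IsHurwitz.toEuclideanCLM_ne_zero (hA : IsHurwitz A) {w : EuclideanSpace ℂ (Fin d)}
    (hw : w ≠ 0) : Matrix.toEuclideanCLM (n := Fin d) (𝕜 := ℂ) A w ≠ 0 := by
  intro h
  have h1 : Module.End.HasEigenvalue (Matrix.toEuclideanLin A) (0 : ℂ) := by
    refine Module.End.hasEigenvalue_of_hasEigenvector (x := w) ⟨?_, hw⟩
    rw [Module.End.mem_eigenspace_iff, zero_smul]
    exact h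
  have h2 := h1.mem_spectrum
  rw [Matrix.spectrum_toLpLin] at h2
  simpa using hA 0 h2

/-! ### Invariant domains -/

variable {D : Set (EuclideanSpace ℂ (Fin d))}

lemma IsCircularlike.linearFlow_I_mul_mem (hcirc : IsCircularlike A D) (s : ℝ)
    {z : EuclideanSpace ℂ (Fin d)} (hz : z ∈ D) : linearFlow A (Complex.I * (s : ℂ)) z ∈ D := by
  obtain ⟨n, hn⟩ := exists_nat_gt |s|
  have hn0 : (0 : ℝ) < n := (abs_nonneg s).trans_lt hn
  have hstep : s / n ∈ Set.Ioo (-(Real.pi / 2)) (Real.pi / 2) := by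
    have h1 : |s / n| < 1 := by
      rw [abs_div, abs_of_pos hn0, div_lt_one hn0]; exact hn
    have h2 := abs_lt.1 h1
    have h3 := Real.pi_gt_three
    constructor <;> linarith
  have hind : ∀ k : ℕ, linearFlow A (k * (Complex.I * ((s / n : ℝ) : ℂ))) z ∈ D := by
    intro k
    induction k with
    | zero => simpa [linearFlow_zero_left] using hz
    | succ k ih =>
      have := hcirc _ hstep _ ih
      rw [← linearFlow_add] at this
      convert this using 2
      push_cast; ring
  convert hind n using 2
  have : (n : ℂ) ≠ 0 := by exact_mod_cast hn0.ne'
  push_cast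
  field_simp

lemma linearFlow_mem_of_re_nonneg (hspiral : IsSpirallike A D) (hcirc : IsCircularlike A D)
    {lam : ℂ} (hlam : 0 ≤ lam.re) {z : EuclideanSpace ℂ (Fin d)} (hz : z ∈ D) :
    linearFlow A lam z ∈ D := by
  have h := hspiral lam.re hlam _ (hcirc.linearFlow_I_mul_mem lam.im hz)
  rw [← linearFlow_add] at h
  rwa [mul_comm, Complex.re_add_im] at h

variable (A D) in
/-- A point `w` of `D` is a *limit of large flow discs* if, for each `R ≥ 0`, points `w'` of `D`
arbitrarily close to `w` have their whole flow disc `{e^{lam A} w' : |lam| ≤ R}` in `D`. -/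
def IsLimitOfFlowDiscs (w : EuclideanSpace ℂ (Fin d)) : Prop :=
  ∀ R : ℝ, ∃ᶠ w' in 𝓝 w, ∀ lam : ℂ, ‖lam‖ ≤ R → linearFlow A lam w' ∈ D

/-- Going far out in `D` and flowing back to a fixed small sphere takes a long time, and all of
that time is available for flowing backwards from the sphere. -/
lemma exists_isLimitOfFlowDiscs (hA : IsHurwitz A) (hD : IsOpen D) (h0 : 0 ∈ D)
    (hspiral : IsSpirallike A D) (hcirc : IsCircularlike A D) (hb : ¬ Bornology.IsBounded D) :
    ∃ w ∈ D, w ≠ 0 ∧ IsLimitOfFlowDiscs A D w := by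
  obtain ⟨r, hr, hrD⟩ := Metric.isOpen_iff.1 hD 0 h0
  have key : ∀ n : ℕ, ∃ w : EuclideanSpace ℂ (Fin d), ‖w‖ = r / 2 ∧
      ∀ lam : ℂ, ‖lam‖ ≤ n → linearFlow A lam w ∈ D := by
    intro n
    -- the flow for times in `[0, n]` maps the sphere of radius `r / 2` into some large ball
    obtain ⟨C, hC⟩ : ∃ C, ∀ p ∈ (Set.Icc (-(n : ℝ)) 0) ×ˢ
        Metric.sphere (0 : EuclideanSpace ℂ (Fin d)) (r / 2),
          ‖linearFlow A (p.1 : ℂ) p.2‖ ≤ C := by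
      have hcont := (continuous_linearFlow A).comp
        (f := fun p : ℝ × EuclideanSpace ℂ (Fin d) => ((p.1 : ℂ), p.2))
        ((Complex.continuous_ofReal.comp continuous_fst).prodMk continuous_snd)
      have hK := (isCompact_Icc (a := -(n : ℝ)) (b := 0)).prod
        (isCompact_sphere (0 : EuclideanSpace ℂ (Fin d)) (r / 2))
      exact hK.exists_bound_of_continuousOn hcont.continuousOn
    obtain ⟨z, hzD, hz⟩ : ∃ z ∈ D, max C (r / 2) < ‖z‖ := by
      by_contra! h
      exact hb ((isBounded_iff_forall_norm_le).2 ⟨_, h⟩)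
    have hcont : Continuous fun t : ℝ => ‖linearFlow A t z‖ :=
      ((continuous_linearFlow A).comp
        (Complex.continuous_ofReal.prodMk continuous_const)).norm
    have hlim : Tendsto (fun t : ℝ => ‖linearFlow A t z‖) atTop (𝓝 0) := by
      simpa using (hA.tendsto_linearFlow z).norm
    obtain ⟨T, hT, hT0⟩ := ((hlim.eventually (gt_mem_nhds (half_pos hr))).and
      (eventually_ge_atTop 0)).exists
    obtain ⟨t, ht, htr⟩ := intermediate_value_Icc' hT0 hcont.continuousOn
      (show r / 2 ∈ Set.Icc ‖linearFlow A (T : ℝ) z‖ ‖linearFlow A (0 : ℝ) z‖ from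
        ⟨hT.le, by
          rw [Complex.ofReal_zero, linearFlow_zero_left]
          exact ((le_max_right _ _).trans_lt hz).le⟩)
    have htn : (n : ℝ) ≤ t := by
      by_contra! h
      have h1 := hC (-t, linearFlow A t z) ⟨⟨by simpa using h.le, by simpa using ht.1⟩, by
        simpa using htr⟩
      simp only [Complex.ofReal_neg, linearFlow_neg_linearFlow] at h1
      exact absurd ((le_max_left _ _).trans_lt hz) (not_lt.2 h1)
    refine ⟨linearFlow A t z, htr, fun lam hlam => ?_⟩
    rw [← linearFlow_add]
    refine linearFlow_mem_of_re_nonneg hspiral hcirc ?_ hzD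
    have := (abs_le.1 ((Complex.abs_re_le_norm lam).trans hlam)).1
    simp only [Complex.add_re, Complex.ofReal_re]
    linarith
  choose w hw hwD using key
  obtain ⟨w0, hw0, φ, hφ, hlim⟩ := (isCompact_sphere (0 : EuclideanSpace ℂ (Fin d))
    (r / 2)).tendsto_subseq (x := w) (fun n => by simpa using hw n)
  have hw0' : ‖w0‖ = r / 2 := by simpa using hw0
  refine ⟨w0, hrD (by simpa [hw0'] using hr), fun h => ?_, fun R => ?_⟩
  · rw [h, norm_zero] at hw0'; linarith
  · refine hlim.frequently (Eventually.frequently ?_)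
    filter_upwards [hφ.tendsto_atTop.eventually (eventually_ge_atTop ⌈R⌉₊)] with n hn lam hlam
    exact hwD _ lam (hlam.trans ((Nat.le_ceil R).trans (by exact_mod_cast hn)))

end

section

/-! ### The Poincaré distance -/

lemma norm_sub_lt_norm_one_sub_conj_mul {a b : ℂ} (ha : ‖a‖ < 1) (hb : ‖b‖ < 1) :
    ‖a - b‖ < ‖1 - (starRingEnd ℂ) b * a‖ := by
  have hid : ‖1 - (starRingEnd ℂ) b * a‖ ^ 2 - ‖a - b‖ ^ 2 = (1 - ‖a‖ ^ 2) * (1 - ‖b‖ ^ 2) := by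
    simp only [← Complex.normSq_eq_norm_sq, Complex.normSq_apply, Complex.sub_re, Complex.sub_im,
      Complex.mul_re, Complex.mul_im, Complex.conj_re, Complex.conj_im, Complex.one_re,
      Complex.one_im]
    ring
  have h1 : 0 < (1 - ‖a‖ ^ 2) * (1 - ‖b‖ ^ 2) :=
    mul_pos (by nlinarith [norm_nonneg a]) (by nlinarith [norm_nonneg b])
  exact lt_of_pow_lt_pow_left₀ 2 (norm_nonneg _) (by linarith)

lemma div_norm_mem_Ico {a b : ℂ} (ha : ‖a‖ < 1) (hb : ‖b‖ < 1) :
    ‖a - b‖ / ‖1 - (starRingEnd ℂ) b * a‖ ∈ Set.Ico (0 : ℝ) 1 := by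
  have h := norm_sub_lt_norm_one_sub_conj_mul ha hb
  exact ⟨by positivity, (div_lt_one ((norm_nonneg _).trans_lt h)).2 h⟩

lemma poincareDist_pos {a b : ℂ} (ha : ‖a‖ < 1) (hb : ‖b‖ < 1) (hab : a ≠ b) :
    0 < poincareDist a b := by
  have h := norm_sub_lt_norm_one_sub_conj_mul ha hb
  exact Real.artanh_pos ⟨div_pos (norm_pos_iff.2 (sub_ne_zero.2 hab)) ((norm_nonneg _).trans_lt h),
    (div_norm_mem_Ico ha hb).2⟩

lemma poincareDist_self (a : ℂ) : poincareDist a a = 0 := by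
  simp [poincareDist]

lemma poincareDist_zero_left (a : ℂ) : poincareDist 0 a = Real.artanh ‖a‖ := by
  simp [poincareDist]

lemma le_artanh {x : ℝ} (hx : x ∈ Set.Ico (0 : ℝ) 1) : x ≤ Real.artanh x := by
  have h := Real.hasSum_log_sub_log_of_abs_lt_one (x := x) (by rw [abs_of_nonneg hx.1]; exact hx.2)
  have h1 := h.tsum_eq ▸ h.summable.le_tsum 0 fun k _ =>
    mul_nonneg (by positivity) (pow_nonneg hx.1 _)
  rw [Real.artanh_eq_half_log ⟨by linarith [hx.1], hx.2.le⟩,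
    Real.log_div (by linarith [hx.1]) (by linarith [hx.2])]
  norm_num at h1
  linarith

lemma tendsto_artanh_zero : Tendsto Real.artanh (𝓝 0) (𝓝 0) := by
  have : ContinuousAt Real.artanh 0 := by
    unfold Real.artanh
    refine ContinuousAt.log ?_ (by simp)
    refine ContinuousAt.sqrt (ContinuousAt.div (by fun_prop) (by fun_prop) (by norm_num))
  simpa [ContinuousAt] using this

/-- A weak form of the Schwarz–Pick lemma: it compares the Euclidean distance in the target with
the Poincaré distance in the source. -/
lemma norm_sub_le_two_mul_poincareDist {g : ℂ → ℂ} (hg : DifferentiableOn ℂ g (Metric.ball 0 1))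
    (hmaps : Set.MapsTo g (Metric.ball 0 1) (Metric.ball 0 1)) {a b : ℂ} (ha : ‖a‖ < 1)
    (hb : ‖b‖ < 1) : ‖g a - g b‖ ≤ 2 * poincareDist a b := by
  -- the disc automorphism sending `0` to `b`
  set m : ℂ → ℂ := fun ζ => (ζ + b) / (1 + (starRingEnd ℂ) b * ζ) with hm
  have hden : ∀ ζ ∈ Metric.ball (0 : ℂ) 1, 1 + (starRingEnd ℂ) b * ζ ≠ 0 := by
    intro ζ hζ h
    have h1 : ‖(starRingEnd ℂ) b * ζ‖ = 1 := by
      rw [eq_neg_of_add_eq_zero_right h]; simp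
    rw [norm_mul, RCLike.norm_conj] at h1
    have h2 : ‖ζ‖ < 1 := by simpa using hζ
    nlinarith [norm_nonneg ζ, norm_nonneg b]
  have hm_maps : Set.MapsTo m (Metric.ball 0 1) (Metric.ball 0 1) := by
    intro ζ hζ
    have h2 : ‖ζ‖ < 1 := by simpa using hζ
    have h3 := norm_sub_lt_norm_one_sub_conj_mul h2 (b := -b) (by simpa using hb)
    simp only [sub_neg_eq_add, map_neg, neg_mul] at h3
    simp only [hm, mem_ball_zero_iff, norm_div]
    exact (div_lt_one ((norm_nonneg _).trans_lt h3)).2 h3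
  have hm_diff : DifferentiableOn ℂ m (Metric.ball 0 1) :=
    DifferentiableOn.div (by fun_prop) (by fun_prop) hden
  have hm0 : m 0 = b := by simp [hm]
  have hlt := norm_sub_lt_norm_one_sub_conj_mul ha hb
  have hne : 1 - (starRingEnd ℂ) b * a ≠ 0 := norm_pos_iff.1 ((norm_nonneg _).trans_lt hlt)
  set c : ℂ := (a - b) / (1 - (starRingEnd ℂ) b * a) with hc
  have hcn : ‖c‖ = ‖a - b‖ / ‖1 - (starRingEnd ℂ) b * a‖ := norm_div _ _
  have hc1 : ‖c‖ ∈ Set.Ico (0 : ℝ) 1 := hcn ▸ div_norm_mem_Ico ha hb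
  have hcball : c ∈ Metric.ball (0 : ℂ) 1 := by simpa using hc1.2
  have hmc : m c = a := by
    have hd := hden c hcball
    rw [hm]
    simp only
    rw [div_eq_iff hd]
    linear_combination div_mul_cancel₀ (a - b) hne
  have hS := Complex.dist_le_div_mul_dist_of_mapsTo_ball (f := g ∘ m) (c := 0) (z := c) (R₁ := 1)
    (R₂ := 2) (hg.comp hm_diff hm_maps) (fun ζ hζ => by
      have h1 := hmaps (hm_maps hζ)
      have h2 := hmaps (hm_maps (Metric.mem_ball_self (x := (0 : ℂ)) one_pos))
      have := dist_triangle_right (g (m ζ)) (g (m 0)) 0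
      simp only [Metric.mem_ball] at h1 h2
      simp only [Metric.mem_closedBall, Function.comp]
      linarith) hcball
  simp only [Function.comp, hm0, hmc, dist_eq_norm, sub_zero] at hS
  have := le_artanh hc1
  rw [poincareDist, ← hcn]
  linarith

/-! ### Carathéodory and Kobayashi hyperbolicity -/

variable {d : ℕ} {D : Set (EuclideanSpace ℂ (Fin d))}

lemma caratheodoryDist_ne_zero {f : EuclideanSpace ℂ (Fin d) → ℂ} (hf : DifferentiableOn ℂ f D)
    (hmaps : Set.MapsTo f D (Metric.ball 0 1)) {z w : EuclideanSpace ℂ (Fin d)} (hz : z ∈ D)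
    (hw : w ∈ D) (hne : f z ≠ f w) : caratheodoryDist D z w ≠ 0 := by
  intro h
  simp only [caratheodoryDist, ENNReal.iSup_eq_zero, ENNReal.ofReal_eq_zero] at h
  exact absurd (poincareDist_pos (by simpa using hmaps hz) (by simpa using hmaps hw) hne)
    (not_lt.2 (h f hf hmaps))

lemma exists_ne_of_caratheodoryDist_ne_zero {z w : EuclideanSpace ℂ (Fin d)}
    (h : caratheodoryDist D z w ≠ 0) : ∃ f : EuclideanSpace ℂ (Fin d) → ℂ,
      DifferentiableOn ℂ f D ∧ Set.MapsTo f D (Metric.ball 0 1) ∧ f z ≠ f w := by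
  by_contra! h'
  refine h ?_
  simp only [caratheodoryDist, ENNReal.iSup_eq_zero, ENNReal.ofReal_eq_zero]
  intro f hf hm
  rw [h' f hf hm, poincareDist_self]

/-- The coordinates of an injective bounded holomorphic map separate points. -/
lemma AreBiholomorphic.isCaratheodoryHyperbolic {G : Set (EuclideanSpace ℂ (Fin d))}
    (hG : Bornology.IsBounded G) (h : AreBiholomorphic D G) : IsCaratheodoryHyperbolic D := by
  obtain ⟨f, g, hf, -, hfm, -, hinv⟩ := h
  obtain ⟨C, hC0, hC⟩ := hG.exists_pos_norm_le
  intro z hz w hw hzw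
  by_contra hne
  have hfne : f z ≠ f w := fun h => hne (hinv.1.injOn hz hw h)
  obtain ⟨i, hi⟩ : ∃ i, f z i ≠ f w i := by
    by_contra! h
    exact hfne (PiLp.ext h)
  refine caratheodoryDist_ne_zero (f := fun x => f x i / (2 * C : ℂ)) ?_ ?_ hz hw ?_ hzw
  · have h := ((2 * C : ℂ)⁻¹ • (EuclideanSpace.proj i : EuclideanSpace ℂ (Fin d) →L[ℂ] ℂ)
      ).differentiable.comp_differentiableOn hf
    simpa [Function.comp_def, div_eq_inv_mul] using h
  · intro x hx
    have h1 := (PiLp.norm_apply_le (f x) i).trans (hC _ (hfm hx))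
    have h2 : ‖(2 * C : ℂ)‖ = 2 * C := by simp [abs_of_pos hC0]
    rw [mem_ball_zero_iff, norm_div, h2, div_lt_one (by positivity)]
    linarith
  · have : (2 * C : ℂ) ≠ 0 := by simpa using hC0.ne'
    simpa [div_left_inj' this] using hi

lemma ofReal_norm_sub_le_lempertFunction {f : EuclideanSpace ℂ (Fin d) → ℂ}
    (hf : DifferentiableOn ℂ f D) (hmaps : Set.MapsTo f D (Metric.ball 0 1))
    (z w : EuclideanSpace ℂ (Fin d)) :
    ENNReal.ofReal (‖f z - f w‖ / 2) ≤ lempertFunction D z w := by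
  simp only [lempertFunction, le_iInf_iff]
  rintro φ a b hφ hφm ha hb rfl rfl
  refine ENNReal.ofReal_le_ofReal ?_
  have := norm_sub_le_two_mul_poincareDist (g := f ∘ φ) (hf.comp hφ hφm) (hmaps.comp hφm)
    (a := a) (b := b) (by simpa using ha) (by simpa using hb)
  simp only [Function.comp] at this
  linarith

/-- The Euclidean bound is additive along chains, which makes the triangle inequality for the
Poincaré distance unnecessary. -/
lemma ofReal_norm_sub_le_kobayashiDist {f : EuclideanSpace ℂ (Fin d) → ℂ}
    (hf : DifferentiableOn ℂ f D) (hmaps : Set.MapsTo f D (Metric.ball 0 1))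
    (z w : EuclideanSpace ℂ (Fin d)) :
    ENNReal.ofReal (‖f z - f w‖ / 2) ≤ kobayashiDist D z w := by
  simp only [kobayashiDist, le_iInf_iff]
  rintro n p rfl rfl -
  induction n with
  | zero => simp
  | succ n ih =>
    rw [Finset.sum_range_succ]
    refine le_trans ?_ (add_le_add ih (ofReal_norm_sub_le_lempertFunction hf hmaps _ _))
    rw [← ENNReal.ofReal_add (by positivity) (by positivity)]
    refine ENNReal.ofReal_le_ofReal ?_
    have := norm_sub_le_norm_sub_add_norm_sub (f (p 0)) (f (p n)) (f (p (n + 1)))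
    linarith

lemma IsCaratheodoryHyperbolic.isKobayashiHyperbolic (h : IsCaratheodoryHyperbolic D) :
    IsKobayashiHyperbolic D := by
  intro z hz w hw hzw
  by_contra hne
  obtain ⟨f, hf, hm, hfne⟩ := exists_ne_of_caratheodoryDist_ne_zero (mt (h z hz w hw) hne)
  have h1 := ofReal_norm_sub_le_kobayashiDist hf hm z w
  rw [hzw, nonpos_iff_eq_zero, ENNReal.ofReal_eq_zero] at h1
  have h2 := norm_pos_iff.2 (sub_ne_zero.2 hfne)
  linarith

/-! ### Degeneracy of the Kobayashi pseudo-distance -/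

lemma lempertFunction_le {φ : ℂ → EuclideanSpace ℂ (Fin d)}
    (hφ : DifferentiableOn ℂ φ (Metric.ball 0 1)) (hm : Set.MapsTo φ (Metric.ball 0 1) D)
    {a b : ℂ} (ha : ‖a‖ < 1) (hb : ‖b‖ < 1) :
    lempertFunction D (φ a) (φ b) ≤ ENNReal.ofReal (poincareDist a b) := by
  unfold lempertFunction
  refine iInf_le_of_le φ (iInf_le_of_le a (iInf_le_of_le b ?_))
  simp [hφ, hm, ha, hb]

lemma lempertFunction_comm (z w : EuclideanSpace ℂ (Fin d)) :
    lempertFunction D z w = lempertFunction D w z := by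
  have hsymm : ∀ a b : ℂ, poincareDist a b = poincareDist b a := by
    intro a b
    unfold poincareDist
    rw [norm_sub_rev a b, ← RCLike.norm_conj (1 - (starRingEnd ℂ) b * a)]
    simp [mul_comm]
  have hle : ∀ z w : EuclideanSpace ℂ (Fin d), lempertFunction D z w ≤ lempertFunction D w z := by
    intro z w
    conv_rhs => unfold lempertFunction
    simp only [le_iInf_iff]
    rintro φ a b hφ hm ha hb rfl rfl
    rw [hsymm]
    exact lempertFunction_le hφ hm (by simpa using hb) (by simpa using ha)
  exact le_antisymm (hle z w) (hle w z)

/-- Affine discs show that nearby points are close. -/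
lemma lempertFunction_le_artanh_of_ball_subset {x y : EuclideanSpace ℂ (Fin d)} {r : ℝ}
    (hr : 0 < r) (hball : Metric.ball x r ⊆ D) (hxy : ‖y - x‖ < r) :
    lempertFunction D x y ≤ ENNReal.ofReal (Real.artanh (‖y - x‖ / r)) := by
  rcases eq_or_ne y x with rfl | hne
  · have := lempertFunction_le (D := D) (φ := fun _ => y) (a := 0) (b := 0)
      (differentiableOn_const _) (fun _ _ => hball (Metric.mem_ball_self hr)) (by simp) (by simp)
    simpa [poincareDist_self] using this
  have hn : 0 < ‖y - x‖ := norm_pos_iff.2 (sub_ne_zero.2 hne)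
  have hb : ‖((‖y - x‖ / r : ℝ) : ℂ)‖ = ‖y - x‖ / r := by
    rw [Complex.norm_real, Real.norm_of_nonneg (by positivity)]
  have h := lempertFunction_le (D := D)
    (φ := fun ζ => x + (ζ * ((r / ‖y - x‖ : ℝ) : ℂ)) • (y - x)) (a := 0)
    (b := ((‖y - x‖ / r : ℝ) : ℂ)) (by fun_prop) (fun ζ hζ => hball (by
      have hζ1 : ‖ζ‖ < 1 := by simpa using hζ
      rw [Metric.mem_ball, dist_eq_norm, add_sub_cancel_left, norm_smul, norm_mul,
        Complex.norm_real, Real.norm_of_nonneg (by positivity), mul_assoc,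
        div_mul_cancel₀ _ hn.ne']
      nlinarith)) (by simp) (by rw [hb]; exact (div_lt_one hr).2 hxy)
  rw [poincareDist_zero_left, hb, ← Complex.ofReal_mul,
    div_mul_div_cancel₀ hr.ne', div_self hn.ne'] at h
  simpa using h

lemma lempertFunction_linearFlow_le {A : Matrix (Fin d) (Fin d) ℂ} {w : EuclideanSpace ℂ (Fin d)}
    {R : ℝ} (hR : 1 < R) (hw : ∀ lam : ℂ, ‖lam‖ ≤ R → linearFlow A lam w ∈ D) :
    lempertFunction D w (linearFlow A 1 w) ≤ ENNReal.ofReal (Real.artanh R⁻¹) := by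
  have hR0 : 0 < R := one_pos.trans hR
  have hb : ‖((R⁻¹ : ℝ) : ℂ)‖ = R⁻¹ := by
    rw [Complex.norm_real, Real.norm_of_nonneg (by positivity)]
  have h := lempertFunction_le (D := D) (φ := fun ζ => linearFlow A (ζ * R) w) (a := 0)
    (b := ((R⁻¹ : ℝ) : ℂ))
    (((differentiable_linearFlow A w).comp (by fun_prop : Differentiable ℂ fun ζ : ℂ => ζ * R)
      ).differentiableOn)
    (fun ζ hζ => hw _ (by
      have hζ1 : ‖ζ‖ < 1 := by simpa using hζ
      rw [norm_mul, Complex.norm_real, Real.norm_of_nonneg hR0.le]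
      nlinarith)) (by simp) (by rw [hb]; exact inv_lt_one_of_one_lt₀ hR)
  rw [poincareDist_zero_left, hb, ← Complex.ofReal_mul, inv_mul_cancel₀ hR0.ne'] at h
  simpa [linearFlow_zero_left] using h

/-- Stated for a general map `F`; it is applied to the flow at time `1`. -/
lemma kobayashiDist_eq_zero_of_frequently {F : EuclideanSpace ℂ (Fin d) → EuclideanSpace ℂ (Fin d)}
    (hD : IsOpen D) {w : EuclideanSpace ℂ (Fin d)} (hwD : w ∈ D) (hFw : F w ∈ D)
    (hF : ContinuousAt F w)
    (h : ∀ ε : ℝ≥0∞, 0 < ε → ∃ᶠ w' in 𝓝 w, lempertFunction D w' (F w') < ε) :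
    kobayashiDist D w (F w) = 0 := by
  obtain ⟨r, hr, hball⟩ := Metric.isOpen_iff.1 hD _ hwD
  obtain ⟨s, hs, hball1⟩ := Metric.isOpen_iff.1 hD _ hFw
  have hart : Tendsto (fun x => ENNReal.ofReal (Real.artanh x)) (𝓝 0) (𝓝 0) := by
    simpa using ENNReal.tendsto_ofReal tendsto_artanh_zero
  refine le_antisymm (ENNReal.le_of_forall_pos_le_add fun ε hε _ => ?_) bot_le
  rw [zero_add]
  have hε3 : (0 : ℝ≥0∞) < ε / 3 := ENNReal.div_pos (by exact_mod_cast hε.ne') (by simp)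
  have hl1 : Tendsto (fun w' => ‖w' - w‖) (𝓝 w) (𝓝 0) :=
    tendsto_iff_norm_sub_tendsto_zero.1 tendsto_id
  have hl2 : Tendsto (fun w' => ‖F w' - F w‖) (𝓝 w) (𝓝 0) :=
    tendsto_iff_norm_sub_tendsto_zero.1 hF
  have hl1r := hl1.div_const r
  have hl2s := hl2.div_const s
  rw [zero_div] at hl1r hl2s
  obtain ⟨w', e2, hw'1, hw'2, hw'3, hw'4⟩ := ((h _ hε3).and_eventually
    ((hl1.eventually (gt_mem_nhds hr)).and ((hl2.eventually (gt_mem_nhds hs)).and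
      (((hart.comp hl1r).eventually (gt_mem_nhds hε3)).and
        ((hart.comp hl2s).eventually (gt_mem_nhds hε3)))))).exists
  have e1 := (lempertFunction_le_artanh_of_ball_subset hr hball hw'1).trans hw'3.le
  have e3 := (lempertFunction_le_artanh_of_ball_subset hs hball1 hw'2).trans hw'4.le
  rw [lempertFunction_comm] at e3
  -- the chain `w, w', F w', F w`
  set p : ℕ → EuclideanSpace ℂ (Fin d) := fun n =>
    match n with
    | 0 => w
    | 1 => w'
    | 2 => F w'
    | _ => F w with hp
  have hpD : ∀ i ≤ 3, p i ∈ D := by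
    intro i hi
    interval_cases i
    · exact hwD
    · exact hball (by simpa [hp, dist_eq_norm] using hw'1)
    · exact hball1 (by simpa [hp, dist_eq_norm] using hw'2)
    · exact hFw
  unfold kobayashiDist
  refine ((iInf_le _ (3 : ℕ)).trans ((iInf_le _ p).trans ((iInf_le _ rfl).trans
    ((iInf_le _ rfl).trans (iInf_le _ hpD))))).trans ?_
  rw [Finset.sum_range_succ, Finset.sum_range_succ, Finset.sum_range_succ, Finset.sum_range_zero,
    zero_add]
  calc _ ≤ (ε : ℝ≥0∞) / 3 + ε / 3 + ε / 3 := add_le_add (add_le_add e1 e2.le) e3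
    _ = ε := ENNReal.add_thirds _

/-- The flow time `1` is negligible on a huge flow disc, so `w` and `e^A w` are at distance `0`. -/
lemma IsLimitOfFlowDiscs.kobayashiDist_eq_zero {A : Matrix (Fin d) (Fin d) ℂ} (hD : IsOpen D)
    {w : EuclideanSpace ℂ (Fin d)} (hwD : w ∈ D) (hwD1 : linearFlow A 1 w ∈ D)
    (hw : IsLimitOfFlowDiscs A D w) : kobayashiDist D w (linearFlow A 1 w) = 0 := by
  refine kobayashiDist_eq_zero_of_frequently hD hwD hwD1 ?_ fun ε hε => ?_
  · exact (continuous_linearFlow_right A 1).continuousAt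
  · have hart : Tendsto (fun x => ENNReal.ofReal (Real.artanh x)) (𝓝 0) (𝓝 0) := by
      simpa using ENNReal.tendsto_ofReal tendsto_artanh_zero
    obtain ⟨R, hR1, hR⟩ : ∃ R : ℝ, 1 < R ∧ ENNReal.ofReal (Real.artanh R⁻¹) < ε :=
      ((eventually_gt_atTop 1).and ((hart.comp tendsto_inv_atTop_zero).eventually
        (gt_mem_nhds hε))).exists
    exact (hw R).mono fun w' hw' => (lempertFunction_linearFlow_le hR1 hw').trans_lt hR

end

section

/-! ### Circle averages of holomorphic maps -/

section CircleAverage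

variable {E : Type*} [NormedAddCommGroup E] [InnerProductSpace ℂ E]

lemma circleIntegrable_zero_one_of_continuousOn {F : Type*} [NormedAddCommGroup F] {g : ℂ → F}
    (hg : ContinuousOn g (Metric.closedBall 0 1)) : CircleIntegrable g 0 1 :=
  ContinuousOn.circleIntegrable' (hg.mono (by rw [abs_one]; exact Metric.sphere_subset_closedBall))

lemma circleAverage_const_add_add (α : ℝ) {u v : ℂ → ℝ} (hu : CircleIntegrable u 0 1)
    (hv : CircleIntegrable v 0 1) : Real.circleAverage (fun ζ => (α + u ζ) + v ζ) 0 1 =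
      α + Real.circleAverage u 0 1 + Real.circleAverage v 0 1 := by
  have hα : CircleIntegrable (fun _ => α) 0 1 := circleIntegrable_const α 0 1
  have hαu : CircleIntegrable (fun ζ => α + u ζ) 0 1 := hα.add hu
  rw [Real.circleAverage_fun_add hαu hv, Real.circleAverage_fun_add hα hu,
    Real.circleAverage_const]

lemma HasDerivAt.eventually_norm_sub_sub_smul_le {f : ℂ → E} {f' : E} {l0 : ℂ}
    (hf : HasDerivAt f f' l0) {κ : ℝ} (hκ : 0 < κ) : ∀ᶠ ρ : ℝ in 𝓝[>] 0, ∀ ζ : ℂ, ‖ζ‖ ≤ 1 →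
      ‖f (l0 + ρ * ζ) - f l0 - (ρ * ζ) • f'‖ ≤ κ * ρ := by
  have h := (hasDerivAt_iff_isLittleO.1 hf).def hκ
  obtain ⟨δ, hδ, hball⟩ := Metric.eventually_nhds_iff.1 h
  filter_upwards [Ioo_mem_nhdsGT hδ] with ρ hρ ζ hζ
  have hn : ‖(ρ : ℂ) * ζ‖ ≤ ρ := by
    rw [norm_mul, Complex.norm_real, Real.norm_of_nonneg hρ.1.le]
    exact mul_le_of_le_one_right hρ.1.le hζ
  have h1 := hball (y := l0 + ρ * ζ) (by
    rw [dist_eq_norm, add_sub_cancel_left]; exact hn.trans_lt hρ.2)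
  rw [add_sub_cancel_left] at h1
  exact h1.trans (by gcongr)

variable [CompleteSpace E]

lemma circleAverage_norm_sq {g : ℂ → E} (hg : Differentiable ℂ g) :
    Real.circleAverage (fun ζ => ‖g ζ‖ ^ 2) 0 1 =
      ‖g 0‖ ^ 2 + Real.circleAverage (fun ζ => ‖g ζ - g 0‖ ^ 2) 0 1 := by
  have hc : Continuous g := hg.continuous
  set L : E →L[ℝ] ℝ :=
    (2 : ℝ) • Complex.reCLM.comp ((innerSL ℂ (g 0)).restrictScalars ℝ) with hL
  have hmean : Real.circleAverage g 0 1 = g 0 := hg.diffContOnCl.circleAverage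
  have hLavg : Real.circleAverage (L ∘ g) 0 1 = L (g 0) := by
    rw [L.circleAverage_comp_comm (circleIntegrable_zero_one_of_continuousOn hc.continuousOn),
      hmean]
  have hLapp : ∀ x, L x = 2 * (inner ℂ (g 0) x).re := fun x => by simp [hL]
  have hfun : (fun ζ => ‖g ζ‖ ^ 2) = fun ζ => (-‖g 0‖ ^ 2 + (L ∘ g) ζ) + ‖g ζ - g 0‖ ^ 2 := by
    funext ζ
    have h1 := norm_sub_sq (𝕜 := ℂ) (g ζ) (g 0)
    have h2 := inner_re_symm (𝕜 := ℂ) (g ζ) (g 0)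
    simp only [RCLike.re_to_complex] at h1 h2
    rw [Function.comp, hLapp, h1, h2]
    ring
  rw [hfun, Real.circleAverage_fun_add, Real.circleAverage_fun_add, hLavg, hLapp,
    Real.circleAverage_const]
  · have h3 := inner_self_eq_norm_sq (𝕜 := ℂ) (g 0)
    simp only [RCLike.re_to_complex] at h3
    rw [h3]; ring
  all_goals
    exact circleIntegrable_zero_one_of_continuousOn (Continuous.continuousOn (by fun_prop))

lemma eventually_circleAverage_norm_sq_ge {f : ℂ → E} (hf : Differentiable ℂ f) {f' : E} {l0 : ℂ}
    (hf' : HasDerivAt f f' l0) (hne : f' ≠ 0) : ∀ᶠ ρ : ℝ in 𝓝[>] 0,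
      ‖f l0‖ ^ 2 + ‖f'‖ ^ 2 / 4 * ρ ^ 2 ≤
        Real.circleAverage (fun ζ => ‖f (l0 + ρ * ζ)‖ ^ 2) 0 1 := by
  have hpos : 0 < ‖f'‖ := norm_pos_iff.2 hne
  filter_upwards [hf'.eventually_norm_sub_sub_smul_le (half_pos hpos), self_mem_nhdsWithin]
    with ρ hρ hρ0
  have hρ0' : (0 : ℝ) < ρ := hρ0
  have hg : Differentiable ℂ fun ζ : ℂ => f (l0 + ρ * ζ) := hf.comp (by fun_prop)
  have hgc : Continuous fun ζ : ℂ => ‖f (l0 + ρ * ζ) - f l0‖ ^ 2 :=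
    (hg.continuous.sub continuous_const).norm.pow 2
  rw [circleAverage_norm_sq hg, mul_zero, add_zero]
  gcongr
  rw [← Real.circleAverage_const (‖f'‖ ^ 2 / 4 * ρ ^ 2) 0 1]
  refine Real.circleAverage_mono
    (circleIntegrable_zero_one_of_continuousOn (Continuous.continuousOn (by fun_prop)))
    (circleIntegrable_zero_one_of_continuousOn hgc.continuousOn) ?_
  intro ζ hζ
  have hζ1 : ‖ζ‖ = 1 := by simpa using hζ
  have h1 := hρ ζ hζ1.le
  have h2 : ‖((ρ : ℂ) * ζ) • f'‖ = ρ * ‖f'‖ := by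
    rw [norm_smul, norm_mul, hζ1, Complex.norm_real, Real.norm_of_nonneg hρ0'.le, mul_one]
  have h3 := norm_sub_norm_le (((ρ : ℂ) * ζ) • f') (f (l0 + ρ * ζ) - f l0)
  rw [norm_sub_rev (((ρ : ℂ) * ζ) • f'), h2] at h3
  have h4 : ρ * ‖f'‖ / 2 ≤ ‖f (l0 + ρ * ζ) - f l0‖ := by linarith
  calc ‖f'‖ ^ 2 / 4 * ρ ^ 2 = (ρ * ‖f'‖ / 2) ^ 2 := by ring
    _ ≤ _ := by gcongr

end CircleAverage

/-! ### A maximum principle along holomorphic curves -/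

/-- Strict superharmonicity at a point: the averages over small circles fall below the value at
the centre by a definite multiple of the squared radius. -/
def IsStrictlySuperharmonicAt (q : ℂ → ℝ) (l0 : ℂ) : Prop :=
  ∃ c > 0, ∀ᶠ ρ : ℝ in 𝓝[>] 0,
    Real.circleAverage (fun ζ : ℂ => q (l0 + ρ * ζ)) 0 1 ≤ q l0 - c * ρ ^ 2

variable {d : ℕ} {D : Set (EuclideanSpace ℂ (Fin d))} {φ : EuclideanSpace ℂ (Fin d) → ℝ}

lemma eventually_forall_add_mul_mem {K : Set ℂ} {l0 : ℂ} (hl0 : l0 ∈ interior K) :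
    ∀ᶠ ρ : ℝ in 𝓝[>] 0, ∀ ζ : ℂ, ‖ζ‖ ≤ 1 → l0 + ρ * ζ ∈ K := by
  obtain ⟨δ, hδ, hball⟩ := Metric.isOpen_iff.1 isOpen_interior l0 hl0
  filter_upwards [Ioo_mem_nhdsGT hδ] with ρ hρ ζ hζ
  refine interior_subset (hball ?_)
  rw [Metric.mem_ball, dist_eq_norm, add_sub_cancel_left, norm_mul, Complex.norm_real,
    Real.norm_of_nonneg hρ.1.le]
  exact (mul_le_of_le_one_right hρ.1.le hζ).trans_lt hρ.2

/-- At an interior maximum of `φ (f l + a) - q l - N ‖a‖²` in the doubled variables `(l, a)`,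
moving `l` along a small circle and `f l + a` along the *affine* disc tangent to `f` changes `a`
only by `o(ρ)`, so the sub-mean value property of `φ` on affine discs contradicts the strict
superharmonicity of `q`. -/
lemma IsContinuousPSHOn.not_isMax_doubled (hφ : IsContinuousPSHOn φ D)
    {f : ℂ → EuclideanSpace ℂ (Fin d)} (hf : Differentiable ℂ f) {K : Set ℂ} {δ : ℝ}
    (hKD : ∀ l ∈ K, ∀ a : EuclideanSpace ℂ (Fin d), ‖a‖ ≤ δ → f l + a ∈ D)
    {q : ℂ → ℝ} (hq : ContinuousOn q K) {l0 : ℂ} (hl0 : l0 ∈ interior K)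
    (hsup : IsStrictlySuperharmonicAt q l0) {a0 : EuclideanSpace ℂ (Fin d)} (ha0 : ‖a0‖ < δ)
    {N : ℝ} (hN : 0 < N)
    (hmax : ∀ l ∈ K, ∀ a : EuclideanSpace ℂ (Fin d), ‖a‖ ≤ δ →
      φ (f l + a) - q l - N * ‖a‖ ^ 2 ≤ φ (f l0 + a0) - q l0 - N * ‖a0‖ ^ 2) : False := by
  obtain ⟨c, hc, hcq⟩ := hsup
  have hf0 := (hf l0).hasDerivAt
  set f' := deriv f l0
  set κ := √(c / (2 * N)) with hκ
  have hκ0 : 0 < κ := Real.sqrt_pos.2 (by positivity)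
  have hκ2 : N * κ ^ 2 = c / 2 := by
    rw [hκ, Real.sq_sqrt (by positivity)]; field_simp
  have hsmall : ∀ᶠ ρ : ℝ in 𝓝[>] 0, κ * ρ < δ - ‖a0‖ := by
    have : Tendsto (fun ρ : ℝ => κ * ρ) (𝓝[>] 0) (𝓝 0) := by
      have h := (continuous_const_mul κ).tendsto (0 : ℝ)
      rw [mul_zero] at h
      exact h.mono_left nhdsWithin_le_nhds
    exact this.eventually (gt_mem_nhds (sub_pos.2 ha0))
  obtain ⟨ρ, hρq, hρf, hρK, hρs, hρ0⟩ := (hcq.and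
    ((hf0.eventually_norm_sub_sub_smul_le hκ0).and
      ((eventually_forall_add_mul_mem hl0).and (hsmall.and self_mem_nhdsWithin)))).exists
  have hρ0' : (0 : ℝ) < ρ := hρ0
  set h : ℂ → EuclideanSpace ℂ (Fin d) :=
    fun ζ => a0 - (f (l0 + ρ * ζ) - f l0 - (ρ * ζ) • f') with hh
  have hhd : Differentiable ℂ h := by
    have : Differentiable ℂ fun ζ : ℂ => f (l0 + ρ * ζ) := hf.comp (by fun_prop)
    have h2 : Differentiable ℂ fun ζ : ℂ => ((ρ : ℂ) * ζ) • f' := by fun_prop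
    exact (differentiable_const a0).sub ((this.sub (differentiable_const _)).sub h2)
  have hhc := hhd.continuous
  have hh0 : h 0 = a0 := by simp [hh]
  have hhκ : ∀ ζ, ‖ζ‖ ≤ 1 → ‖h ζ - a0‖ ≤ κ * ρ := fun ζ hζ => by
    rw [hh, sub_sub_cancel_left, norm_neg]; exact hρf ζ hζ
  have hhδ : ∀ ζ, ‖ζ‖ ≤ 1 → ‖h ζ‖ ≤ δ := fun ζ hζ => by
    have h1 := hhκ ζ hζ
    have h2 := norm_le_norm_add_norm_sub' (h ζ) a0
    linarith
  have hline : ∀ ζ : ℂ, (f l0 + a0) + ζ • ((ρ : ℂ) • f') = f (l0 + ρ * ζ) + h ζ := by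
    intro ζ
    simp only [smul_smul, mul_comm ζ, hh]
    abel
  have hD : ∀ ζ : ℂ, ‖ζ‖ ≤ 1 → (f l0 + a0) + ζ • ((ρ : ℂ) • f') ∈ D := fun ζ hζ => by
    rw [hline]; exact hKD _ (hρK ζ hζ) _ (hhδ ζ hζ)
  have hpsh := hφ.2 (f l0 + a0) ((ρ : ℂ) • f') hD
  have hball : ∀ ζ : ℂ, ζ ∈ Metric.closedBall (0 : ℂ) 1 → ‖ζ‖ ≤ 1 := fun ζ hζ => by simpa using hζ
  have hφi : CircleIntegrable (fun ζ : ℂ => φ ((f l0 + a0) + ζ • ((ρ : ℂ) • f'))) 0 1 :=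
    circleIntegrable_zero_one_of_continuousOn (hφ.1.comp (Continuous.continuousOn (by fun_prop))
      fun ζ hζ => hD ζ (hball ζ hζ))
  have hqi : CircleIntegrable (fun ζ : ℂ => q (l0 + ρ * ζ)) 0 1 :=
    circleIntegrable_zero_one_of_continuousOn (hq.comp (Continuous.continuousOn (by fun_prop))
      fun ζ hζ => hρK ζ (hball ζ hζ))
  have hhi : CircleIntegrable (fun ζ : ℂ => N * ‖h ζ‖ ^ 2) 0 1 :=
    circleIntegrable_zero_one_of_continuousOn (Continuous.continuousOn (by fun_prop))
  set m := φ (f l0 + a0) - q l0 - N * ‖a0‖ ^ 2 with hm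
  have hle : Real.circleAverage (fun ζ : ℂ => φ ((f l0 + a0) + ζ • ((ρ : ℂ) • f'))) 0 1 ≤
      Real.circleAverage (fun ζ : ℂ => (m + q (l0 + ρ * ζ)) + N * ‖h ζ‖ ^ 2) 0 1 := by
    refine Real.circleAverage_mono hφi
      (((circleIntegrable_const m 0 1).add hqi).add hhi) fun ζ hζ => ?_
    have hζ1 : ‖ζ‖ ≤ 1 := by
      have : ‖ζ‖ = 1 := by simpa using hζ
      exact this.le
    have := hmax _ (hρK ζ hζ1) _ (hhδ ζ hζ1)
    rw [hline]
    linarith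
  have hhavg : Real.circleAverage (fun ζ : ℂ => N * ‖h ζ‖ ^ 2) 0 1 ≤
      N * ‖a0‖ ^ 2 + c / 2 * ρ ^ 2 := by
    have e1 : Real.circleAverage (fun ζ : ℂ => N * ‖h ζ‖ ^ 2) 0 1 =
        N * Real.circleAverage (fun ζ : ℂ => ‖h ζ‖ ^ 2) 0 1 :=
      Real.circleAverage_fun_smul (a := N)
    have e2 : Real.circleAverage (fun ζ : ℂ => ‖h ζ - h 0‖ ^ 2) 0 1 ≤ (κ * ρ) ^ 2 := by
      refine Real.circleAverage_mono_on_of_le_circle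
        (circleIntegrable_zero_one_of_continuousOn (Continuous.continuousOn (by fun_prop)))
        fun ζ hζ => ?_
      have hζ1 : ‖ζ‖ = 1 := by simpa using hζ
      have := hhκ ζ hζ1.le
      rw [hh0]
      gcongr
    rw [e1, circleAverage_norm_sq hhd, hh0, ← hκ2]
    rw [hh0] at e2
    nlinarith
  rw [circleAverage_const_add_add m hqi hhi] at hle
  have : 0 < c / 2 * ρ ^ 2 := by positivity
  linarith

/-- Although the sub-mean value property is only assumed on affine discs, `φ ∘ f` obeys the maximum
principle relative to strictly superharmonic functions. -/
lemma IsContinuousPSHOn.comp_le_of_le_frontier (hφ : IsContinuousPSHOn φ D) (hD : IsOpen D)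
    {f : ℂ → EuclideanSpace ℂ (Fin d)} (hf : Differentiable ℂ f) {K : Set ℂ} (hK : IsCompact K)
    (hfK : Set.MapsTo f K D) {q : ℂ → ℝ} (hq : ContinuousOn q K)
    (hsup : ∀ l ∈ interior K, IsStrictlySuperharmonicAt q l)
    (hbd : ∀ l ∈ frontier K, φ (f l) ≤ q l) : ∀ l ∈ K, φ (f l) ≤ q l := by
  intro l1 hl1
  by_contra! hlt
  set m := φ (f l1) - q l1 with hm
  have hm0 : 0 < m := sub_pos.2 hlt
  have hfc := hf.continuous
  obtain ⟨δ, hδ, hδD, hδφ⟩ : ∃ δ > 0, (∀ l ∈ K, ∀ a : EuclideanSpace ℂ (Fin d), ‖a‖ ≤ δ →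
      f l + a ∈ D) ∧ ∀ l ∈ K, ∀ a : EuclideanSpace ℂ (Fin d), ‖a‖ ≤ δ →
        φ (f l + a) < φ (f l) + m := by
    have hT : IsCompact (f '' K) := hK.image hfc
    have hTD : f '' K ⊆ D := hfK.image_subset
    obtain ⟨δ1, hδ1, h1⟩ := hT.exists_cthickening_subset_open hD hTD
    have h2 := hT.uniformContinuousAt_of_continuousAt φ
      (fun x hx => hφ.1.continuousAt (hD.mem_nhds (hTD hx))) (Metric.dist_mem_uniformity hm0)
    obtain ⟨δ2, hδ2, h2⟩ := Metric.mem_uniformity_dist.1 h2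
    refine ⟨min δ1 (δ2 / 2), by positivity, fun l hl a ha => h1 ?_, fun l hl a ha => ?_⟩
    · refine Metric.closedBall_subset_cthickening (Set.mem_image_of_mem f hl) δ1 ?_
      rw [Metric.mem_closedBall, dist_eq_norm, add_sub_cancel_left]
      exact ha.trans (min_le_left _ _)
    · have h3 : dist (φ (f l)) (φ (f l + a)) < m := by
        refine h2 (a := f l) (b := f l + a) ?_ (Set.mem_image_of_mem f hl)
        rw [dist_eq_norm, sub_add_cancel_left, norm_neg]
        exact (ha.trans (min_le_right _ _)).trans_lt (by linarith)
      rw [Real.dist_eq] at h3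
      linarith [(abs_lt.1 h3).1]
  set S : Set (ℂ × EuclideanSpace ℂ (Fin d)) :=
    K ×ˢ Metric.closedBall (0 : EuclideanSpace ℂ (Fin d)) δ with hS
  have hSc : IsCompact S := hK.prod (isCompact_closedBall _ _)
  have hΨ : ContinuousOn (fun p : ℂ × EuclideanSpace ℂ (Fin d) => φ (f p.1 + p.2) - q p.1) S := by
    refine ContinuousOn.sub (hφ.1.comp (Continuous.continuousOn (by fun_prop)) ?_)
      (hq.comp continuous_fst.continuousOn fun p hp => hp.1)
    exact fun p hp => hδD _ hp.1 _ (by simpa using hp.2)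
  obtain ⟨C, hC⟩ := hSc.exists_bound_of_continuousOn hΨ
  -- with this penalty the maximum cannot lie on `‖a‖ = δ`
  set N := (|C| + 1) / δ ^ 2 with hN
  have hN0 : 0 < N := by positivity
  have hNδ : N * δ ^ 2 = |C| + 1 := by rw [hN]; field_simp
  obtain ⟨⟨l0, a0⟩, h0S, h0max⟩ := hSc.exists_isMaxOn
    ⟨(l1, 0), hl1, by simpa using hδ.le⟩
    (hΨ.sub (Continuous.continuousOn (f := fun p : ℂ × EuclideanSpace ℂ (Fin d) => N * ‖p.2‖ ^ 2)
      (by fun_prop)))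
  have hmax : ∀ l ∈ K, ∀ a : EuclideanSpace ℂ (Fin d), ‖a‖ ≤ δ →
      φ (f l + a) - q l - N * ‖a‖ ^ 2 ≤ φ (f l0 + a0) - q l0 - N * ‖a0‖ ^ 2 :=
    fun l hl a ha => h0max (a := (l, a)) ⟨hl, by simpa using ha⟩
  have ha0 : ‖a0‖ ≤ δ := by simpa using h0S.2
  have hmm : m ≤ φ (f l0 + a0) - q l0 - N * ‖a0‖ ^ 2 := by
    simpa [hm] using hmax l1 hl1 0 (by simpa using hδ.le)
  have ha0' : ‖a0‖ < δ := by
    refine lt_of_le_of_ne ha0 fun h => ?_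
    have h1 := (le_abs_self _).trans (hC (l0, a0) h0S)
    simp only at h1
    rw [h, hNδ] at hmm
    linarith [le_abs_self C]
  have hl0 : l0 ∈ interior K := by
    by_contra hni
    have h1 := hbd l0 ⟨subset_closure h0S.1, hni⟩
    have h2 := hδφ l0 h0S.1 a0 ha0
    have : 0 ≤ N * ‖a0‖ ^ 2 := by positivity
    linarith
  exact hφ.not_isMax_doubled hf hδD hq hl0 (hsup l0 hl0) ha0' hN0 hmax

/-! ### Bounded plurisubharmonic functions on large discs -/

lemma isStrictlySuperharmonicAt_log_sub_sq (α β : ℝ) {η : ℝ} (hη : 0 < η) {l0 : ℂ} (hl0 : l0 ≠ 0) :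
    IsStrictlySuperharmonicAt (fun l => (α + β * Real.log ‖l‖) + -η * ‖l‖ ^ 2) l0 := by
  refine ⟨η / 4, by positivity, ?_⟩
  have hsq := eventually_circleAverage_norm_sq_ge differentiable_id (hasDerivAt_id l0)
    (one_ne_zero (α := ℂ))
  filter_upwards [hsq, Ioo_mem_nhdsGT (norm_pos_iff.2 hl0)] with ρ hρ hρ0
  have hne : ∀ ζ : ℂ, ‖ζ‖ ≤ 1 → l0 + ρ * ζ ≠ 0 := by
    intro ζ hζ h
    have h1 : ‖l0‖ = ρ * ‖ζ‖ := by
      rw [eq_neg_of_add_eq_zero_left h, norm_neg, norm_mul, Complex.norm_real,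
        Real.norm_of_nonneg hρ0.1.le]
    nlinarith [hρ0.1, hρ0.2]
  have hlog : Real.circleAverage (fun ζ : ℂ => Real.log ‖l0 + ρ * ζ‖) 0 1 = Real.log ‖l0‖ := by
    have h := InnerProductSpace.HarmonicOnNhd.circleAverage_eq
      (f := fun ζ : ℂ => Real.log ‖l0 + ρ * ζ‖) (c := 0) (R := 1) fun ζ hζ => by
        refine AnalyticAt.harmonicAt_log_norm (f := fun ζ : ℂ => l0 + ρ * ζ) (by fun_prop)
          (hne ζ (by simpa using hζ))
    simpa using h
  have hlogi : CircleIntegrable (fun ζ : ℂ => β * Real.log ‖l0 + ρ * ζ‖) 0 1 := by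
    refine circleIntegrable_zero_one_of_continuousOn (continuousOn_const.mul
      (ContinuousOn.log (Continuous.continuousOn (by fun_prop)) fun ζ hζ => ?_))
    exact norm_ne_zero_iff.2 (hne ζ (by simpa using hζ))
  have hsqi : CircleIntegrable (fun ζ : ℂ => -η * ‖l0 + ρ * ζ‖ ^ 2) 0 1 :=
    circleIntegrable_zero_one_of_continuousOn (Continuous.continuousOn (by fun_prop))
  have e1 : Real.circleAverage (fun ζ : ℂ => β * Real.log ‖l0 + ρ * ζ‖) 0 1 =
      β * Real.circleAverage (fun ζ : ℂ => Real.log ‖l0 + ρ * ζ‖) 0 1 :=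
    Real.circleAverage_fun_smul (a := β)
  have e2 : Real.circleAverage (fun ζ : ℂ => -η * ‖l0 + ρ * ζ‖ ^ 2) 0 1 =
      -η * Real.circleAverage (fun ζ : ℂ => ‖l0 + ρ * ζ‖ ^ 2) 0 1 :=
    Real.circleAverage_fun_smul (a := -η)
  rw [circleAverage_const_add_add α hlogi hsqi, e1, e2, hlog]
  simp only [id, norm_one] at hρ
  nlinarith

/-- Hadamard's three circles theorem, with the trivial bound `M` on the outer circle. -/
lemma IsContinuousPSHOn.comp_le_log_interpolation (hφ : IsContinuousPSHOn φ D) (hD : IsOpen D)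
    {f : ℂ → EuclideanSpace ℂ (Fin d)} (hf : Differentiable ℂ f) {ρ R : ℝ} (hρ : 0 < ρ)
    (hρR : ρ < R) (hfD : ∀ l, ‖l‖ ≤ R → f l ∈ D) {S M : ℝ}
    (hS : ∀ l, ‖l‖ = ρ → φ (f l) ≤ S) (hM : ∀ z ∈ D, φ z ≤ M) {l : ℂ} (hl : ρ ≤ ‖l‖)
    (hlR : ‖l‖ ≤ R) :
    φ (f l) ≤ S + (M - S) / (Real.log R - Real.log ρ) * (Real.log ‖l‖ - Real.log ρ) := by
  set β := (M - S) / (Real.log R - Real.log ρ) with hβ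
  have hlog : 0 < Real.log R - Real.log ρ := sub_pos.2 (Real.log_lt_log hρ hρR)
  have hβR : β * (Real.log R - Real.log ρ) = M - S := div_mul_cancel₀ _ hlog.ne'
  set K : Set ℂ := {l | ρ ≤ ‖l‖ ∧ ‖l‖ ≤ R} with hKdef
  have hKclosed : IsClosed K :=
    (isClosed_le continuous_const continuous_norm).inter
      (isClosed_le continuous_norm continuous_const)
  have hK : IsCompact K := (isCompact_closedBall (0 : ℂ) R).of_isClosed_subset hKclosed
    fun l hl => by simpa using hl.2
  have hK0 : ∀ l ∈ K, l ≠ 0 := fun l hl => norm_pos_iff.1 (hρ.trans_le hl.1)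
  have hfr : ∀ l ∈ frontier K, l ∈ K ∧ (‖l‖ = ρ ∨ ‖l‖ = R) := by
    intro l hl
    have hlK : l ∈ K := hKclosed.frontier_subset hl
    refine ⟨hlK, ?_⟩
    by_contra! hne
    refine hl.2 (mem_interior.2 ⟨{l | ρ < ‖l‖ ∧ ‖l‖ < R}, fun x hx => ⟨hx.1.le, hx.2.le⟩, ?_,
      lt_of_le_of_ne hlK.1 hne.1.symm, lt_of_le_of_ne hlK.2 hne.2⟩)
    exact (isOpen_lt continuous_const continuous_norm).inter
      (isOpen_lt continuous_norm continuous_const)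
  have key : ∀ η > 0, φ (f l) ≤
      ((S - β * Real.log ρ + η * R ^ 2) + β * Real.log ‖l‖) + -η * ‖l‖ ^ 2 := by
    intro η hη
    refine hφ.comp_le_of_le_frontier hD hf hK (fun l hl => hfD l hl.2)
      (q := fun l => ((S - β * Real.log ρ + η * R ^ 2) + β * Real.log ‖l‖) + -η * ‖l‖ ^ 2)
      ?_ ?_ ?_ l ⟨hl, hlR⟩
    · refine ContinuousOn.add (continuousOn_const.add (continuousOn_const.mul
        (ContinuousOn.log continuous_norm.continuousOn fun l hl =>
          norm_ne_zero_iff.2 (hK0 l hl)))) (Continuous.continuousOn (by fun_prop))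
    · exact fun l hl => isStrictlySuperharmonicAt_log_sub_sq _ _ hη (hK0 l (interior_subset hl))
    · intro l hl
      obtain ⟨hlK, h | h⟩ := hfr l hl
      · have h1 := hS l h
        have h2 : ρ ^ 2 ≤ R ^ 2 := by gcongr
        rw [h]
        nlinarith
      · have h1 := hM _ (hfD l hlK.2)
        rw [h]
        nlinarith
  have hlim : Tendsto (fun η : ℝ => ((S - β * Real.log ρ + η * R ^ 2) + β * Real.log ‖l‖) +
      -η * ‖l‖ ^ 2) (𝓝[>] 0) (𝓝 (((S - β * Real.log ρ + 0 * R ^ 2) + β * Real.log ‖l‖) +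
        -0 * ‖l‖ ^ 2)) :=
    (Continuous.tendsto (by fun_prop) _).mono_left nhdsWithin_le_nhds
  have := ge_of_tendsto hlim (by filter_upwards [self_mem_nhdsWithin] with η hη using key η hη)
  linarith

/-! ### The core of an unbounded domain -/

/-- A Liouville property: along the flow disc through `w`, a bounded plurisubharmonic function is a
limit of bounded subharmonic functions on ever larger discs, so it cannot exceed its value
at `w`. -/
lemma IsLimitOfFlowDiscs.comp_linearFlow_le {A : Matrix (Fin d) (Fin d) ℂ} (hD : IsOpen D)
    {w : EuclideanSpace ℂ (Fin d)} (hwD : w ∈ D) (hw : IsLimitOfFlowDiscs A D w)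
    (hφ : IsContinuousPSHOn φ D) (hbdd : BddAbove (φ '' D)) {l : ℂ} (hl : linearFlow A l w ∈ D) :
    φ (linearFlow A l w) ≤ φ w := by
  rcases eq_or_ne l 0 with rfl | hl0
  · rw [linearFlow_zero_left]
  obtain ⟨M, hM⟩ := hbdd
  refine le_of_forall_pos_le_add fun ε hε => ?_
  have hε3 : 0 < ε / 3 := by positivity
  have hln : 0 < ‖l‖ := norm_pos_iff.2 hl0
  set S := φ w + ε / 3 with hS
  -- uniform control of `φ` on small flow discs near `w`
  have hcont : ContinuousAt (fun p : ℂ × EuclideanSpace ℂ (Fin d) => φ (linearFlow A p.1 p.2))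
      ((0 : ℂ), w) := by
    refine ContinuousAt.comp (g := φ)
      (f := fun p : ℂ × EuclideanSpace ℂ (Fin d) => linearFlow A p.1 p.2) ?_
      (continuous_linearFlow A).continuousAt
    simp only [linearFlow_zero_left]
    exact hφ.1.continuousAt (hD.mem_nhds hwD)
  have hnear : ∀ᶠ p : ℂ × EuclideanSpace ℂ (Fin d) in 𝓝 (0 : ℂ) ×ˢ 𝓝 w,
      φ (linearFlow A p.1 p.2) < S := by
    rw [← nhds_prod_eq]
    refine hcont.eventually (gt_mem_nhds ?_)
    simp only [linearFlow_zero_left, hS]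
    linarith
  obtain ⟨P, hP, Q, hQ, hPQ⟩ := eventually_prod_iff.1 hnear
  obtain ⟨ρ', hρ', hρ'P⟩ := Metric.eventually_nhds_iff.1 hP
  set ρ := min (ρ' / 2) (‖l‖ / 2) with hρdef
  have hρ : 0 < ρ := by positivity
  have hρρ' : ρ < ρ' := (min_le_left _ _).trans_lt (by linarith)
  have hρl : ρ < ‖l‖ := (min_le_right _ _).trans_lt (by linarith)
  have hcont2 : ∀ᶠ w' in 𝓝 w, φ (linearFlow A l w) - ε / 3 < φ (linearFlow A l w') := by
    have : ContinuousAt (fun w' => φ (linearFlow A l w')) w :=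
      ContinuousAt.comp (g := φ) (f := linearFlow A l)
        (hφ.1.continuousAt (hD.mem_nhds hl)) (continuous_linearFlow_right A l).continuousAt
    exact this.eventually (lt_mem_nhds (by linarith))
  have hlim : Tendsto (fun R : ℝ => (M - S) / (Real.log R - Real.log ρ) *
      (Real.log ‖l‖ - Real.log ρ)) atTop (𝓝 0) := by
    have h1 : Tendsto (fun R : ℝ => Real.log R - Real.log ρ) atTop atTop :=
      tendsto_atTop_add_const_right _ _ Real.tendsto_log_atTop
    simpa using (h1.const_div_atTop (M - S)).mul_const (Real.log ‖l‖ - Real.log ρ)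
  obtain ⟨R, hR, hRl⟩ := ((hlim.eventually (gt_mem_nhds hε3)).and
    (eventually_ge_atTop ‖l‖)).exists
  obtain ⟨w', hw'R, hw'Q, hw'c⟩ := ((hw R).and_eventually (hQ.and hcont2)).exists
  have h3 := hφ.comp_le_log_interpolation hD (differentiable_linearFlow A w') hρ
    (hρl.trans_le hRl) hw'R
    (fun x hx => (hPQ (hρ'P (by simpa [hx] using hρρ')) hw'Q).le)
    (fun z hz => hM (Set.mem_image_of_mem φ hz)) hρl.le hRl
  linarith

lemma isStrictlySuperharmonicAt_sub_norm_sq {f : ℂ → EuclideanSpace ℂ (Fin d)}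
    (hf : Differentiable ℂ f) {f' : EuclideanSpace ℂ (Fin d)} {l0 : ℂ} (hf' : HasDerivAt f f' l0)
    (α : ℝ) {ε η : ℝ} (hε : 0 < ε) (hη : 0 ≤ η) (hηε : η < ε * ‖f'‖ ^ 2 / 4) :
    IsStrictlySuperharmonicAt (fun l => (α + -ε * ‖f l‖ ^ 2) + η * ‖l‖ ^ 2) l0 := by
  have hne : f' ≠ 0 := by
    rintro rfl
    simp at hηε
    linarith
  refine ⟨ε * ‖f'‖ ^ 2 / 4 - η, by linarith, ?_⟩
  filter_upwards [eventually_circleAverage_norm_sq_ge hf hf' hne, self_mem_nhdsWithin]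
    with ρ hρ hρ0
  have hρ0' : (0 : ℝ) < ρ := hρ0
  have hfc := hf.continuous
  have hfi : CircleIntegrable (fun ζ : ℂ => -ε * ‖f (l0 + ρ * ζ)‖ ^ 2) 0 1 :=
    circleIntegrable_zero_one_of_continuousOn (Continuous.continuousOn (by fun_prop))
  have hsqi : CircleIntegrable (fun ζ : ℂ => η * ‖l0 + ρ * ζ‖ ^ 2) 0 1 :=
    circleIntegrable_zero_one_of_continuousOn (Continuous.continuousOn (by fun_prop))
  have e1 : Real.circleAverage (fun ζ : ℂ => -ε * ‖f (l0 + ρ * ζ)‖ ^ 2) 0 1 =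
      -ε * Real.circleAverage (fun ζ : ℂ => ‖f (l0 + ρ * ζ)‖ ^ 2) 0 1 :=
    Real.circleAverage_fun_smul (a := -ε)
  have e2 : Real.circleAverage (fun ζ : ℂ => η * ‖l0 + ρ * ζ‖ ^ 2) 0 1 =
      η * Real.circleAverage (fun ζ : ℂ => ‖l0 + ρ * ζ‖ ^ 2) 0 1 :=
    Real.circleAverage_fun_smul (a := η)
  have e3 : Real.circleAverage (fun ζ : ℂ => ‖l0 + ρ * ζ‖ ^ 2) 0 1 = ‖l0‖ ^ 2 + ρ ^ 2 := by
    rw [circleAverage_norm_sq (g := fun ζ : ℂ => l0 + ρ * ζ) (by fun_prop), mul_zero, add_zero]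
    congr 1
    refine Real.circleAverage_const_on_circle fun ζ hζ => ?_
    have hζ1 : ‖ζ‖ = 1 := by simpa using hζ
    rw [add_sub_cancel_left, norm_mul, hζ1, Complex.norm_real, Real.norm_of_nonneg hρ0'.le, mul_one]
  rw [circleAverage_const_add_add α hfi hsqi, e1, e2, e3]
  nlinarith

/-- `‖·‖²` is strictly subharmonic along the non-constant flow curve through `w`; a strictly
plurisubharmonic `φ` would be so as well, which its maximum at `w` forbids. -/
lemma IsLimitOfFlowDiscs.mem_domainCore {A : Matrix (Fin d) (Fin d) ℂ} (hA : IsHurwitz A)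
    (hD : IsOpen D) {w : EuclideanSpace ℂ (Fin d)} (hwD : w ∈ D) (hw0 : w ≠ 0)
    (hw : IsLimitOfFlowDiscs A D w) : w ∈ domainCore D := by
  refine ⟨hwD, fun φ hφ hbdd => ?_⟩
  rintro ⟨ε, hε, r, hr, hψ⟩
  set f : ℂ → EuclideanSpace ℂ (Fin d) := fun l => linearFlow A l w with hf
  have hfd : Differentiable ℂ f := differentiable_linearFlow A w
  have hfc := hfd.continuous
  have hf0 : f 0 = w := linearFlow_zero_left A w
  set B := Matrix.toEuclideanCLM (n := Fin d) (𝕜 := ℂ) A with hB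
  have hBw : 0 < ‖B w‖ := norm_pos_iff.2 (hA.toEuclideanCLM_ne_zero hw0)
  have hBc : Continuous fun l => ‖B (f l)‖ := (B.continuous.comp hfc).norm
  have hev : ∀ᶠ l in 𝓝 (0 : ℂ), f l ∈ Metric.ball w r ∧ f l ∈ D ∧ ‖B w‖ / 2 < ‖B (f l)‖ := by
    refine (hfc.continuousAt.eventually ?_).and ((hfc.continuousAt.eventually ?_).and
      (hBc.continuousAt.eventually ?_))
    · rw [hf0]; exact Metric.ball_mem_nhds w hr
    · rw [hf0]; exact hD.mem_nhds hwD
    · exact lt_mem_nhds (by simp only [hf0]; linarith)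
  obtain ⟨s', hs', hball⟩ := Metric.eventually_nhds_iff.1 hev
  set s := s' / 2 with hs
  have hs0 : 0 < s := by positivity
  have hsK : ∀ l ∈ Metric.closedBall (0 : ℂ) s,
      f l ∈ Metric.ball w r ∧ f l ∈ D ∧ ‖B w‖ / 2 < ‖B (f l)‖ := fun l hl =>
    hball ((Metric.mem_closedBall.1 hl).trans_lt (by linarith))
  set η := ε * ‖B w‖ ^ 2 / 32 with hη
  have hη0 : 0 < η := by positivity
  have key := hψ.comp_le_of_le_frontier Metric.isOpen_ball hfd (isCompact_closedBall (0 : ℂ) s)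
    (fun l hl => (hsK l hl).1)
    (q := fun l => ((φ w - η * s ^ 2) + -ε * ‖f l‖ ^ 2) + η * ‖l‖ ^ 2)
    (Continuous.continuousOn (by fun_prop)) (fun l hl => by
      refine isStrictlySuperharmonicAt_sub_norm_sq hfd (hasDerivAt_linearFlow A l w) _ hε hη0.le ?_
      have h1 := (hsK l (interior_subset hl)).2.2
      have h2 : (‖B w‖ / 2) ^ 2 < ‖B (f l)‖ ^ 2 := by gcongr
      have h3 : 0 < ε * ‖B w‖ ^ 2 := by positivity
      change η < ε * ‖B (f l)‖ ^ 2 / 4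
      nlinarith) (fun l hl => by
      have h1 : l ∈ Metric.sphere (0 : ℂ) s := Metric.frontier_closedBall_subset_sphere hl
      have h2 : ‖l‖ = s := by simpa using h1
      have h3 := hw.comp_linearFlow_le hD hwD hφ hbdd
        (hsK l (Metric.sphere_subset_closedBall h1)).2.1
      rw [h2]
      change φ (linearFlow A l w) - ε * ‖linearFlow A l w‖ ^ 2 ≤
        φ w - η * s ^ 2 + -ε * ‖linearFlow A l w‖ ^ 2 + η * s ^ 2
      linarith) 0 (by simpa using hs0.le)
  simp only [hf0, norm_zero] at key
  have : 0 < η * s ^ 2 := by positivity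
  linarith

/-- On a bounded domain `‖·‖²` itself is a bounded strictly plurisubharmonic function. -/
lemma domainCore_eq_empty_of_isBounded (hb : Bornology.IsBounded D) : domainCore D = ∅ := by
  refine Set.eq_empty_iff_forall_notMem.2 fun ζ hζ => ?_
  refine hζ.2 (fun z => ‖z‖ ^ 2) ⟨Continuous.continuousOn (by fun_prop), fun a b _ => ?_⟩ ?_ ?_
  · rw [circleAverage_norm_sq (g := fun l : ℂ => a + l • b) (by fun_prop), zero_smul, add_zero]
    exact le_add_of_nonneg_right (Real.circleAverage_nonneg_of_nonneg fun _ _ => by positivity)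
  · obtain ⟨C, hC⟩ := isBounded_iff_forall_norm_le.1 hb
    refine ⟨C ^ 2, ?_⟩
    rintro _ ⟨z, hz, rfl⟩
    exact pow_le_pow_left₀ (norm_nonneg z) (hC z hz) 2
  · refine ⟨1, one_pos, 1, one_pos, ?_⟩
    simp only [one_mul, sub_self]
    exact ⟨continuousOn_const, fun a b _ => by rw [Real.circleAverage_const]⟩

end

end

/-! ### The equivalence -/

theorem corollary1p4 (d : ℕ) (A : Matrix (Fin d) (Fin d) ℂ) (hA : IsHurwitz A)
    (D : Set (EuclideanSpace ℂ (Fin d))) (hD : IsDomainIn D) (h0 : 0 ∈ D)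
    (hspiral : IsSpirallike A D) (hcirc : IsCircularlike A D) :
    List.TFAE [
      Bornology.IsBounded D,
      ∃ G : Set (EuclideanSpace ℂ (Fin d)),
        IsDomainIn G ∧ Bornology.IsBounded G ∧ AreBiholomorphic D G,
      IsKobayashiHyperbolic D,
      domainCore D = ∅,
      IsCaratheodoryHyperbolic D] := by
  tfae_have 1 → 2 := fun h => ⟨D, hD, h, id, id, differentiableOn_id, differentiableOn_id,
    Set.mapsTo_id D, Set.mapsTo_id D, fun _ _ => rfl, fun _ _ => rfl⟩
  tfae_have 2 → 5 := fun ⟨_, _, hb, hbih⟩ => hbih.isCaratheodoryHyperbolic hb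
  tfae_have 5 → 3 := fun h => h.isKobayashiHyperbolic
  tfae_have 3 → 1 := by
    intro h
    by_contra hb
    obtain ⟨w, hwD, hw0, hw⟩ := exists_isLimitOfFlowDiscs hA hD.1 h0 hspiral hcirc hb
    have hwD1 : linearFlow A 1 w ∈ D := linearFlow_mem_of_re_nonneg hspiral hcirc (by simp) hwD
    have heq := h w hwD _ hwD1 (hw.kobayashiDist_eq_zero hD.1 hwD hwD1)
    exact hw0 (hA.eq_zero_of_linearFlow_one_eq heq.symm)
  tfae_have 1 → 4 := domainCore_eq_empty_of_isBounded
  tfae_have 4 → 1 := by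
    intro h
    by_contra hb
    obtain ⟨w, hwD, hw0, hw⟩ := exists_isLimitOfFlowDiscs hA hD.1 h0 hspiral hcirc hb
    exact (h ▸ hw.mem_domainCore hA hD.1 hwD hw0 : w ∈ (∅ : Set (EuclideanSpace ℂ (Fin d))))
  tfae_finish
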